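/- Conventions. For a finite-dimensional complex Lie algebra $\mathfrak g$, the index is $\chi[\mathfrak g]=\min_{f\in\mathfrak g^*}\dim\mathfrak g_f$, where $\mathfrak g_f=\{x\in\mathfrak g : f([x,y])=0\ \text{for all } y\in\mathfrak g\}$. Let $\underline a=(a_1,\dots,a_k)$ and $\underline b=(b_1,\dots,b_t)$ be finite sequences of natural numbers with the same sum $n$, and let $(e_1,\dots,e_n)$ be the canonical basis of $\mathbb C^n$. The biparabolic subalgebra $\mathfrak q(\underline a\mid\underline b)$ of $\mathfrak{gl}(n)=\mathfrak{gl}(n,\mathbb C)$ is the set of matrices that leave stable all the subspaces $\langle e_1,\dots,e_{a_1+\cdots+a_i}\rangle$ ($0\le i\le k$) and all the subspaces $\langle e_{b_1+\cdots+b_j+1},\dots,e_n\rangle$ ($0\le j\le t$); zero terms in $\underline a$ or $\underline b$ have no effect. The parabolic subalgebra $\mathfrak p(\underline a)$ of $\mathfrak{gl}(n)$ is $\mathfrak q(\underline a\mid n)$. A composition of $n$ is a finite sequence of positive integers with sum $n$. Statement. Let $\underline a=(a_1,\dots,a_k)$ and $\underline b=(b_1,\dots,b_t)$ be two compositions of $n$.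 Then: 1) $\chi[\mathfrak q(\underline a\mid\underline b)]=\chi[\mathfrak q(\underline b\mid\underline a)]$. 2) $\chi[\mathfrak q(\underline a\mid\underline b)]=\chi[\mathfrak q(a_k,\dots,a_1\mid b_t,\dots,b_1)]$. 3) $\chi[\mathfrak q(\underline a\mid\underline b)]=\chi[\mathfrak p(a_1,\dots,a_k,b_t,\dots,b_1)]$, where the parabolic subalgebra is in $\mathfrak{gl}(2n)$. 4) For $1\le i\le k-1$ put $t_i=(a_1+\cdots+a_i)-(a_{i+1}+\cdots+a_k)$. Then $$\chi[\mathfrak p(a_1,\dots,a_k)]=\begin{cases}\chi[\mathfrak q(a_1,\dots,a_i\mid a_k,\dots,a_{i+1},t_i)] & \text{if } t_i\ge 0,\\ \chi[\mathfrak q(a_1,\dots,a_i,-t_i\mid a_k,\dots,a_{i+1})] & \text{if } t_i<0.\end{cases}$$ 5) If $1\le i<k$ and $i+1<i'\le k$ satisfy $a_1+\cdots+a_i=a_{i'}+\cdots+a_k$, then $$\chi[\mathfrak p(\underline a)]=\chi[\mathfrak p(a_1,\dots,a_i,a_{i'},\dots,a_k)]+\chi[\mathfrak p(a_{i+1},\dots,a_{i'-1})].$$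 6) If $1\le i<k$ and $1\le j<t$ satisfy $a_1+\cdots+a_i=b_1+\cdots+b_j$, then $$\chi[\mathfrak q(\underline a\mid\underline b)]=\chi[\mathfrak q(a_1,\dots,a_i\mid b_1,\dots,b_j)]+\chi[\mathfrak q(a_{i+1},\dots,a_k\mid b_{j+1},\dots,b_t)].$$ -/

import Mathlib

attribute [local instance 100] LieRing.ofAssociativeRing

/-- The stabilizer `𝔤_f = {x ∈ 𝔤 | f([x, y]) = 0 for all y ∈ 𝔤}` of a linear form `f ∈ 𝔤*`
for the coadjoint action of a complex Lie algebra `𝔤`. -/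
def coadjointStabilizer {L : Type*} [LieRing L] [LieAlgebra ℂ L] (f : Module.Dual ℂ L) :
    Submodule ℂ L where
  carrier := {x | ∀ y : L, f ⁅x, y⁆ = 0}
  zero_mem' := fun y => by simp
  add_mem' := fun {x x'} hx hx' y => by rw [add_lie, map_add, hx y, hx' y, add_zero]
  smul_mem' := fun c x hx y => by rw [smul_lie, map_smul, hx y, smul_zero]

/-- The index `χ[𝔤] = min {dim 𝔤_f | f ∈ 𝔤*}` of a (finite-dimensional) complex Lie algebra.
The infimum is over a non-empty set of natural numbers, so it is a minimum. -/
noncomputable def lieIndex (L : Type*) [LieRing L] [LieAlgebra ℂ L] : ℕ :=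
  ⨅ f : Module.Dual ℂ L, Module.finrank ℂ (coadjointStabilizer f)

/-- The partial sums `0, a₁, a₁ + a₂, …, a₁ + ⋯ + a_k` of a finite sequence of natural numbers. -/
def partialSums (a : List ℕ) : Set ℕ :=
  {m | ∃ i : ℕ, i ≤ a.length ∧ (a.take i).sum = m}

/-- The biparabolic (seaweed) subalgebra `𝔮(a ∣ b)` of `𝔤𝔩(n, ℂ)`, for finite sequences `a`, `b` of
natural numbers with sum `n`, in its standard position. With `e₀, …, e₍ₙ₋₁₎` the canonical basis of
`ℂⁿ`, it consists of the matrices that leave stable every subspace `⟨e₀, …, e₍ₘ₋₁₎⟩`, `m` a partial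
sum of `a` (first condition), and every subspace `⟨eₘ, …, e₍ₙ₋₁₎⟩`, `m` a partial sum of `b`
(second condition). Zero terms of `a` and `b` have no effect. -/
def biparabolic (n : ℕ) (a b : List ℕ) : LieSubalgebra ℂ (Matrix (Fin n) (Fin n) ℂ) where
  carrier := {x |
    (∀ m ∈ partialSums a, ∀ r s : Fin n, (s : ℕ) < m → m ≤ (r : ℕ) → x r s = 0) ∧
    (∀ m ∈ partialSums b, ∀ r s : Fin n, m ≤ (s : ℕ) → (r : ℕ) < m → x r s = 0)}
  zero_mem' := ⟨fun _ _ _ _ _ _ => rfl, fun _ _ _ _ _ _ => rfl⟩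
  add_mem' := by
    rintro x y ⟨hx, hx'⟩ ⟨hy, hy'⟩
    refine ⟨fun m hm r s h1 h2 => ?_, fun m hm r s h1 h2 => ?_⟩
    · rw [Matrix.add_apply, hx m hm r s h1 h2, hy m hm r s h1 h2, add_zero]
    · rw [Matrix.add_apply, hx' m hm r s h1 h2, hy' m hm r s h1 h2, add_zero]
  smul_mem' := by
    rintro c x ⟨hx, hx'⟩
    refine ⟨fun m hm r s h1 h2 => ?_, fun m hm r s h1 h2 => ?_⟩
    · rw [Matrix.smul_apply, hx m hm r s h1 h2, smul_zero]
    · rw [Matrix.smul_apply, hx' m hm r s h1 h2, smul_zero]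
  lie_mem' := by
    rintro x y ⟨hx, hx'⟩ ⟨hy, hy'⟩
    have key : ∀ u v : Matrix (Fin n) (Fin n) ℂ, ∀ r s : Fin n,
        (∀ t, u r t = 0 ∨ v t s = 0) → (u * v) r s = 0 := fun u v r s h => by
      rw [Matrix.mul_apply]
      exact Finset.sum_eq_zero fun t _ => mul_eq_zero.2 (h t)
    refine ⟨fun m hm r s h1 h2 => ?_, fun m hm r s h1 h2 => ?_⟩
    · rw [Ring.lie_def, Matrix.sub_apply, key x y r s fun t => ?_, key y x r s fun t => ?_, sub_zero]
      · exact (lt_or_ge (t : ℕ) m).imp (fun h => hy m hm r t h h2) (fun h => hx m hm t s h1 h)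
      · exact (lt_or_ge (t : ℕ) m).imp (fun h => hx m hm r t h h2) (fun h => hy m hm t s h1 h)
    · rw [Ring.lie_def, Matrix.sub_apply, key x y r s fun t => ?_, key y x r s fun t => ?_, sub_zero]
      · exact (le_or_gt m (t : ℕ)).imp (fun h => hy' m hm r t h h2) (fun h => hx' m hm t s h1 h)
      · exact (le_or_gt m (t : ℕ)).imp (fun h => hx' m hm r t h h2) (fun h => hy' m hm t s h1 h)

theorem partialSums_cons (x : ℕ) (a : List ℕ) :
    partialSums (x :: a) = {0} ∪ (fun m => x + m) '' partialSums a := by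
  ext m
  constructor
  · rintro ⟨i, hi, rfl⟩
    cases i with
    | zero => left; simp
    | succ i => right; exact ⟨_, ⟨i, by simpa using hi, rfl⟩, by simp⟩
  · rintro (rfl | ⟨_, ⟨i, hi, rfl⟩, rfl⟩)
    · exact ⟨0, by simp, by simp⟩
    · exact ⟨i + 1, by simpa using hi, by simp⟩

theorem partialSums_filter (a : List ℕ) : partialSums (a.filter (· ≠ 0)) = partialSums a := by
  induction a with
  | nil => rfl
  | cons x a ih =>
    by_cases hx : x = 0
    · subst hx
      have h0 : (0 : ℕ) ∈ partialSums a := ⟨0, by simp, by simp⟩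
      rw [partialSums_cons, List.filter_cons_of_neg (by simp), ih]
      simp [h0]
    · rw [List.filter_cons_of_pos (by simpa using hx), partialSums_cons, partialSums_cons, ih]

/-- Deleting the zero terms of `a` and `b` does not change `𝔮(a ∣ b)`. -/
theorem biparabolic_filter (n : ℕ) (a b : List ℕ) :
    biparabolic n (a.filter (· ≠ 0)) (b.filter (· ≠ 0)) = biparabolic n a b := by
  ext x
  change _ ∧ _ ↔ _ ∧ _
  rw [partialSums_filter, partialSums_filter]

/-- The parabolic subalgebra `𝔭(a) = 𝔮(a ∣ n)` of `𝔤𝔩(n, ℂ)`, for `a` a finite sequence of natural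
numbers with sum `n`. -/
def parabolic (n : ℕ) (a : List ℕ) : LieSubalgebra ℂ (Matrix (Fin n) (Fin n) ℂ) :=
  biparabolic n a [n]

/-- The index `χ[𝔮(a ∣ b)]` of the biparabolic subalgebra `𝔮(a ∣ b)` of `𝔤𝔩(n, ℂ)`. -/
noncomputable def biparabolicIndex (n : ℕ) (a b : List ℕ) : ℕ :=
  lieIndex (biparabolic n a b)

/-- The index `χ[𝔭(a)]` of the parabolic subalgebra `𝔭(a)` of `𝔤𝔩(n, ℂ)`. -/
noncomputable def parabolicIndex (n : ℕ) (a : List ℕ) : ℕ :=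
  lieIndex (parabolic n a)

/-! ### Coadjoint stabilizers, the index, and generic forms in a pencil -/

section Index

open Module

variable {L L' L₁ L₂ Q : Type*} [LieRing L] [LieAlgebra ℂ L] [LieRing L'] [LieAlgebra ℂ L']
  [LieRing L₁] [LieAlgebra ℂ L₁] [LieRing L₂] [LieAlgebra ℂ L₂] [LieRing Q] [LieAlgebra ℂ Q]

/-! The algebras involved consist of all matrices supported on the positions of a preorder. Negative
transposition gives 1); combined with the order-reversing permutation of the basis it gives 2). A
common cut of both compositions makes the matrices block diagonal, and additivity of the index on
products gives 6).

The heart is 4), `parabolicIndex_append`. For B ≤ A, cut 𝔭(a, b) in 𝔤𝔩(A + B) into blocks; the upper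
right corner V is an abelian ideal. Let ξ be the form that pairs the basis of ℂ^B, in reverse order,
with the first B basis vectors of ℂ^A. Its restriction to V has an open orbit in V*, and the
stabilizer of this restriction is, modulo V, 𝔮(a ∣ b reversed, A − B).

Passing to this quotient preserves the index (`lieIndex_eq_of_open_orbit`). When f agrees with ξ on
V, its stabilizer has the dimension of that of its restriction to 𝔮
(`finrank_coadjointStabilizer_of_orthogonal`); and a form of minimal stabilizer can be chosen close
enough to ξ to be conjugated to one agreeing with ξ on V.

The case A = B is 3); A < B follows by reversal; 5) combines 4), 6) and 3). -/

theorem mem_coadjointStabilizer {f : Dual ℂ L} {x : L} :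
    x ∈ coadjointStabilizer f ↔ ∀ y : L, f ⁅x, y⁆ = 0 := Iff.rfl

theorem lieIndex_le (f : Dual ℂ L) : lieIndex L ≤ finrank ℂ (coadjointStabilizer f) :=
  ciInf_le (OrderBot.bddBelow _) f

theorem exists_finrank_coadjointStabilizer_eq_lieIndex (L : Type*) [LieRing L] [LieAlgebra ℂ L] :
    ∃ f : Dual ℂ L, finrank ℂ (coadjointStabilizer f) = lieIndex L :=
  ciInf_mem fun f : Dual ℂ L => finrank ℂ (coadjointStabilizer f)

theorem finrank_coadjointStabilizer_congr (e : L ≃ₗ⁅ℂ⁆ L') (f : Dual ℂ L) (f' : Dual ℂ L')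
    (h : ∀ x, f' (e x) = f x) :
    finrank ℂ (coadjointStabilizer f) = finrank ℂ (coadjointStabilizer f') := by
  have hmap : (coadjointStabilizer f).map (e.toLinearEquiv : L →ₗ[ℂ] L') =
      coadjointStabilizer f' := by
    ext y
    constructor
    · rintro ⟨x, hx, rfl⟩ z
      obtain ⟨z, rfl⟩ := e.surjective z
      have : f' ⁅e x, e z⁆ = 0 := by rw [← LieEquiv.map_lie, h]; exact hx z
      exact this
    · intro hy
      obtain ⟨x, rfl⟩ := e.surjective y
      refine ⟨x, fun z => ?_, rfl⟩
      rw [← h, LieEquiv.map_lie]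
      exact hy _
  rw [← hmap]
  exact (e.toLinearEquiv.submoduleMap _).finrank_eq

theorem lieIndex_le_of_equiv (e : L ≃ₗ⁅ℂ⁆ L') : lieIndex L ≤ lieIndex L' := by
  obtain ⟨f', hf'⟩ := exists_finrank_coadjointStabilizer_eq_lieIndex L'
  rw [← hf', ← finrank_coadjointStabilizer_congr e (f' ∘ₗ (e.toLinearEquiv : L →ₗ[ℂ] L')) f'
    fun _ => rfl]
  exact lieIndex_le _

/-- The index is an isomorphism invariant. -/
theorem lieIndex_congr (e : L ≃ₗ⁅ℂ⁆ L') : lieIndex L = lieIndex L' :=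
  (lieIndex_le_of_equiv e).antisymm (lieIndex_le_of_equiv e.symm)

theorem finrank_coadjointStabilizer_of_prod [FiniteDimensional ℂ L₁] [FiniteDimensional ℂ L₂]
    (e : (L₁ × L₂) ≃ₗ[ℂ] L) (he : ∀ x y : L₁ × L₂, e (⁅x.1, y.1⁆, ⁅x.2, y.2⁆) = ⁅e x, e y⁆)
    (f₁ : Dual ℂ L₁) (f₂ : Dual ℂ L₂) (f : Dual ℂ L) (hf : ∀ x, f (e x) = f₁ x.1 + f₂ x.2) :
    finrank ℂ (coadjointStabilizer f) =
      finrank ℂ (coadjointStabilizer f₁) + finrank ℂ (coadjointStabilizer f₂) := by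
  have hmap : ((coadjointStabilizer f₁).prod (coadjointStabilizer f₂)).map (e : L₁ × L₂ →ₗ[ℂ] L) =
      coadjointStabilizer f := by
    ext y
    constructor
    · rintro ⟨x, ⟨h₁, h₂⟩, rfl⟩ z
      obtain ⟨z, rfl⟩ := e.surjective z
      have h₁ := h₁ z.1
      have h₂ := h₂ z.2
      change f ⁅e x, e z⁆ = 0
      rw [← he, hf]
      simp only [h₁, h₂, add_zero]
    · intro hy
      obtain ⟨x, rfl⟩ := e.surjective y
      refine ⟨x, ⟨fun z => ?_, fun z => ?_⟩, rfl⟩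
      · have := hy (e (z, 0))
        rw [← he, hf] at this
        simpa using this
      · have := hy (e (0, z))
        rw [← he, hf] at this
        simpa using this
  rw [← hmap, ← (e.submoduleMap _).finrank_eq]
  rw [← finrank_prod, ← LinearMap.finrank_range_of_inj (f := (coadjointStabilizer f₁).subtype.prodMap
    (coadjointStabilizer f₂).subtype) (Subtype.val_injective.prodMap Subtype.val_injective),
    LinearMap.range_prodMap, Submodule.range_subtype, Submodule.range_subtype]

/-- The index of a direct product is the sum of the indices. -/
theorem lieIndex_of_prod [FiniteDimensional ℂ L₁] [FiniteDimensional ℂ L₂]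
    (e : (L₁ × L₂) ≃ₗ[ℂ] L) (he : ∀ x y : L₁ × L₂, e (⁅x.1, y.1⁆, ⁅x.2, y.2⁆) = ⁅e x, e y⁆) :
    lieIndex L = lieIndex L₁ + lieIndex L₂ := by
  apply le_antisymm
  · obtain ⟨f₁, h₁⟩ := exists_finrank_coadjointStabilizer_eq_lieIndex L₁
    obtain ⟨f₂, h₂⟩ := exists_finrank_coadjointStabilizer_eq_lieIndex L₂
    rw [← h₁, ← h₂, ← finrank_coadjointStabilizer_of_prod e he f₁ f₂
      (f₁.coprod f₂ ∘ₗ (e.symm : L →ₗ[ℂ] L₁ × L₂)) fun x => by simp]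
    exact lieIndex_le _
  · obtain ⟨f, h⟩ := exists_finrank_coadjointStabilizer_eq_lieIndex L
    rw [← h, finrank_coadjointStabilizer_of_prod e he
      (f ∘ₗ (e : L₁ × L₂ →ₗ[ℂ] L) ∘ₗ LinearMap.inl ℂ L₁ L₂)
      (f ∘ₗ (e : L₁ × L₂ →ₗ[ℂ] L) ∘ₗ LinearMap.inr ℂ L₁ L₂) f fun x => by
        simp [← map_add]]
    exact add_le_add (lieIndex_le _) (lieIndex_le _)

/-- Let `V` be a subspace of `L` that meets the radical of `(x, y) ↦ f ⁅x, y⁆` trivially, and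
whose orthogonal is the direct sum of `V` and of the image of a Lie algebra `Q`. Then the
stabilizer of `f` has the dimension of the stabilizer of the restriction of `f` to `Q`. -/
theorem finrank_coadjointStabilizer_of_orthogonal [FiniteDimensional ℂ L] (V : Submodule ℂ L)
    (f : Dual ℂ L) (hV : ∀ v ∈ V, (∀ x : L, f ⁅x, v⁆ = 0) → v = 0)
    (ι : Q →ₗ⁅ℂ⁆ L) (hι : ∀ q, ι q ∈ V → q = 0)
    (hιV : ∀ q, ∀ v ∈ V, f ⁅ι q, v⁆ = 0)
    (horth : ∀ x, (∀ v ∈ V, f ⁅x, v⁆ = 0) → ∃ q, x - ι q ∈ V) :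
    finrank ℂ (coadjointStabilizer f) =
      finrank ℂ (coadjointStabilizer (f ∘ₗ (ι : Q →ₗ[ℂ] L))) := by
  let s : Q × V →ₗ[ℂ] L := (ι : Q →ₗ[ℂ] L).coprod V.subtype
  have hs : ∀ p, s p = ι p.1 + p.2 := fun p => rfl
  -- `K` is the stabilizer of `f` read in Q × V. It maps bijectively onto the stabilizer of `f` by
  -- `s`, and onto that of the restriction of `f` by the first projection.
  let K : Submodule ℂ (Q × V) := (coadjointStabilizer f).comap s
  have skew : ∀ x y, f ⁅x, y⁆ = - f ⁅y, x⁆ := fun x y => by rw [← lie_skew, map_neg]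
  let g : K →ₗ[ℂ] coadjointStabilizer f := s.restrict (p := K) fun p hp => hp
  have hg : Function.Bijective g := by
    constructor
    · rw [← LinearMap.ker_eq_bot, LinearMap.ker_eq_bot']
      rintro ⟨⟨q, v⟩, hp⟩ h
      have h0 : ι q + v = 0 := congrArg Subtype.val h
      have hq : q = 0 := hι q (by rw [eq_neg_of_add_eq_zero_left h0]; exact V.neg_mem v.2)
      subst hq
      have hv : (v : L) = 0 := by simpa using h0
      ext <;> simp [hv]
    · rintro ⟨x, hx : ∀ y : L, f ⁅x, y⁆ = 0⟩
      obtain ⟨q, hq⟩ := horth x fun v _ => hx v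
      have : s (q, ⟨x - ι q, hq⟩) = x := by simp [hs]
      exact ⟨⟨(q, ⟨_, hq⟩), by change s _ ∈ coadjointStabilizer f; rwa [this]⟩, Subtype.ext this⟩
  have hK : ∀ p ∈ K, LinearMap.fst ℂ Q V p ∈ coadjointStabilizer (f ∘ₗ (ι : Q →ₗ[ℂ] L)) := by
    rintro ⟨q, v⟩ hp q'
    have h1 : f ⁅ι q + v, ι q'⁆ = 0 := hp (ι q')
    rw [add_lie, map_add, skew v, hιV q' v v.2, neg_zero, add_zero, ← LieHom.map_lie] at h1
    exact h1
  let g' : K →ₗ[ℂ] coadjointStabilizer (f ∘ₗ (ι : Q →ₗ[ℂ] L)) := (LinearMap.fst ℂ Q V).restrict hK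
  have hg' : Function.Bijective g' := by
    constructor
    · rw [← LinearMap.ker_eq_bot, LinearMap.ker_eq_bot']
      rintro ⟨⟨q, v⟩, hp⟩ h
      have hq : q = 0 := congrArg Subtype.val h
      subst hq
      have hv : v = 0 := Subtype.ext <| hV v v.2 fun x => by
        have := hp x
        simp only [hs, map_zero, zero_add] at this
        rw [skew, this, neg_zero]
      subst hv
      rfl
    · rintro ⟨q, hq⟩
      let B : L →ₗ[ℂ] Dual ℂ L := LinearMap.mk₂ ℂ (fun x y => f ⁅x, y⁆)
        (by simp) (by simp) (by simp) (by simp)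
      -- A form vanishing on the orthogonal of V lies in `W = B(V)`. This applies to `B (ι q)`, and
      -- the resulting `v` corrects `ι q` to an element of the stabilizer of `f`.
      let W : Submodule ℂ (Dual ℂ L) := V.map B
      have hW : B (ι q) ∈ W := by
        rw [← Subspace.dualCoannihilator_dualAnnihilator_eq (W := W),
          Submodule.mem_dualAnnihilator]
        intro y hy
        rw [Submodule.mem_dualCoannihilator] at hy
        obtain ⟨q', hq'⟩ := horth y fun v hv => by
          rw [skew, show f ⁅v, y⁆ = 0 from hy _ ⟨v, hv, rfl⟩, neg_zero]
        have h1 : f ⁅ι q, ι q'⁆ = 0 := by rw [← LieHom.map_lie]; exact hq q'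
        have h2 := hιV q _ hq'
        rw [lie_sub, map_sub, h1, sub_zero] at h2
        exact h2
      obtain ⟨v, hv, hBv⟩ := hW
      refine ⟨⟨(q, ⟨-v, V.neg_mem hv⟩), fun (y : L) => ?_⟩, rfl⟩
      have := LinearMap.congr_fun hBv y
      change f ⁅v, y⁆ = f ⁅ι q, y⁆ at this
      rw [hs, add_lie, neg_lie, map_add, map_neg, this, add_neg_cancel]
  exact (LinearEquiv.ofBijective g hg).finrank_eq.symm.trans
    (LinearEquiv.ofBijective g' hg').finrank_eq

/-- The kernel of a generic member of a pencil of linear maps is not larger than that of a given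
direction. -/
theorem finite_finrank_ker_lt_finrank_ker_add_smul {X Y : Type*} [AddCommGroup X] [Module ℂ X]
    [AddCommGroup Y] [Module ℂ Y] [FiniteDimensional ℂ X] (A C : X →ₗ[ℂ] Y) :
    {s : ℂ | finrank ℂ A.ker < finrank ℂ (C + s • A).ker}.Finite := by
  obtain ⟨K, hK⟩ := A.ker.exists_isCompl
  have hAK : (A ∘ₗ K.subtype).ker = ⊥ := by
    rw [LinearMap.ker_eq_bot']
    intro k hk
    exact Subtype.ext ((Submodule.disjoint_def.1 hK.disjoint) _ hk k.2)
  obtain ⟨P, hP⟩ := LinearMap.exists_leftInverse_of_injective _ hAK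
  -- A vector of K killed by C + sA is an eigenvector of `T` for −s. Outside finitely many s the
  -- kernel therefore misses the complement K of ker A.
  let T : End ℂ K := P ∘ₗ C ∘ₗ K.subtype
  refine ((Module.End.finite_hasEigenvalue T).image fun μ => -μ).subset fun s hs => ?_
  refine ⟨-s, ?_, neg_neg s⟩
  by_contra hμ
  refine absurd (Set.mem_ofPred.1 hs) (not_lt.2 ?_)
  have hdisj : Disjoint (C + s • A).ker K := by
    rw [Submodule.disjoint_def]
    intro x hx hxK
    have hPA : P (A x) = ⟨x, hxK⟩ := LinearMap.congr_fun hP ⟨x, hxK⟩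
    have h1 : T ⟨x, hxK⟩ = (-s) • ⟨x, hxK⟩ := by
      have h2 := congrArg P (LinearMap.mem_ker.1 hx)
      simp only [LinearMap.add_apply, LinearMap.smul_apply, map_add, map_smul, hPA, map_zero] at h2
      rw [neg_smul]
      exact eq_neg_of_add_eq_zero_left h2
    by_contra hx0
    exact hμ (Module.End.hasEigenvalue_of_hasEigenvector (x := ⟨x, hxK⟩)
      ⟨Module.End.mem_eigenspace_iff.2 h1, fun h => hx0 (congrArg Subtype.val h)⟩)
  have h1 := Submodule.finrank_add_finrank_le_of_disjoint hdisj
  have h2 := Submodule.finrank_add_eq_of_isCompl hK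
  omega

theorem finite_finrank_coadjointStabilizer_lt_add_smul [FiniteDimensional ℂ L] (f ξ : Dual ℂ L) :
    {s : ℂ | finrank ℂ (coadjointStabilizer f) <
      finrank ℂ (coadjointStabilizer (ξ + s • f))}.Finite := by
  let B : Dual ℂ L → L →ₗ[ℂ] Dual ℂ L := fun f => LinearMap.mk₂ ℂ (fun x y => f ⁅x, y⁆)
    (by simp) (by simp) (by simp) (by simp)
  have hB : ∀ f, coadjointStabilizer f = (B f).ker := fun f => by
    ext x
    rw [LinearMap.mem_ker, mem_coadjointStabilizer]
    exact ⟨fun h => LinearMap.ext h, fun h y => LinearMap.congr_fun h y⟩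
  have hadd : ∀ s : ℂ, B (ξ + s • f) = B ξ + s • B f := fun s => by ext; rfl
  have h := finite_finrank_ker_lt_finrank_ker_add_smul (B f) (B ξ)
  convert h using 3 with s
  rw [← hadd, ← hB, ← hB]

end Index

/-! ### Open orbits and reduction to the stabilizer of a form on an ideal -/

section Algebra

open Module Filter Topology

variable {S : Type*} [NormedRing S] [NormedAlgebra ℂ S] [FiniteDimensional ℂ S]

/-- Conjugation by a unit. -/
noncomputable def unitConjLieEquiv (u : Sˣ) : S ≃ₗ⁅ℂ⁆ S where
  toFun x := u * x * ↑u⁻¹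
  invFun x := ↑u⁻¹ * x * u
  map_add' x y := by rw [mul_add, add_mul]
  map_smul' c x := by simp
  map_lie' {x y} := by simp [Ring.lie_def, mul_sub, sub_mul, mul_assoc]
  left_inv x := by simp [mul_assoc]
  right_inv x := by simp [mul_assoc]

/-- If a linear form `ξ` on `S` satisfies `ξ(⁅S, v⁆) ≠ 0` for all non-zero `v ∈ V`, then all forms
close to `ξ` are, on `V`, conjugate to `ξ`. -/
theorem eventually_exists_unit_conj (V : Submodule ℂ S) (ξ f : Dual ℂ S)
    (hV : ∀ v ∈ V, (∀ x : S, ξ ⁅x, v⁆ = 0) → v = 0) :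
    ∀ᶠ s : ℂ in 𝓝 0, ∃ u : Sˣ, ∀ v ∈ V, (ξ + s • f) v = ξ (u * v * ↑u⁻¹) := by
  have : CompleteSpace S := FiniteDimensional.complete ℂ S
  let b := finBasis ℂ V
  let ξc : S →L[ℂ] ℂ := LinearMap.toContinuousLinearMap ξ
  -- `F` is the orbit map of ξ|V in coordinates, made total by `Ring.inverse`; its derivative `D` at
  -- 1 is x ↦ ξ(⁅x, ·⁆)|V.
  let F : S → (Fin (finrank ℂ V) → ℂ) := fun x i => ξc (x * b i * Ring.inverse x)
  let D : S →L[ℂ] (Fin (finrank ℂ V) → ℂ) := LinearMap.toContinuousLinearMap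
    (LinearMap.pi fun i => ξ ∘ₗ (LinearMap.mulRight ℂ (b i : S) - LinearMap.mulLeft ℂ (b i : S)))
  have hD : ∀ x i, D x i = ξ ⁅x, (b i : S)⁆ := fun x i => rfl
  have hF : HasStrictFDerivAt F D 1 := by
    rw [hasStrictFDerivAt_pi']
    intro i
    have h1 := ((hasStrictFDerivAt_id (𝕜 := ℂ) (1 : S)).mul_const' (b i : S)).mul'
      (hasStrictFDerivAt_ringInverse (𝕜 := ℂ) (1 : Sˣ))
    have h2 := ξc.hasStrictFDerivAt.comp (1 : S) h1
    refine h2.congr_fderiv ?_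
    ext x
    simp [hD, Ring.lie_def, ξc, neg_add_eq_sub]
  have hsurj : D.range = ⊤ := by
    by_contra hne
    obtain ⟨φ, hφ, hle⟩ := Submodule.exists_le_ker_of_lt_top _ (lt_top_iff_ne_top.2 hne)
    refine hφ ?_
    -- A functional vanishing on the range of `D` is given by a vector v ∈ V with ξ(⁅S, v⁆) = 0, so
    -- it is zero by `hV`.
    have hφD : ∀ x, φ (D x) = ξ ⁅x, ((∑ i, φ (Pi.single i 1) • b i : V) : S)⁆ := fun x => by
      rw [LinearMap.pi_apply_eq_sum_univ φ (D x)]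
      have hsingle : ∀ i : Fin (finrank ℂ V), (fun j => if i = j then (1 : ℂ) else 0) =
          Pi.single i 1 := fun i => by ext j; simp [Pi.single_apply, eq_comm]
      simp [hD, lie_sum, mul_comm, hsingle]
    have h0 := hV _ (∑ i, φ (Pi.single i 1) • b i : V).2 fun x => by
      rw [← hφD]; exact hle ⟨x, rfl⟩
    have h1 := Fintype.linearIndependent_iff.1 b.linearIndependent _ (Subtype.ext h0)
    refine LinearMap.pi_ext' fun i => LinearMap.ext_ring ?_
    exact h1 i
  have hmap := hF.map_nhds_eq_of_surj hsurj
  have hF1 : F 1 = fun i => ξ (b i) := by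
    funext i; simp [F, ξc]
  have htend : Tendsto (fun s : ℂ => fun i => (ξ + s • f) (b i : S)) (𝓝 0) (𝓝 (F 1)) := by
    rw [hF1, tendsto_pi_nhds]
    intro i
    have : Continuous fun s : ℂ => ξ (b i : S) + s * f (b i : S) := by fun_prop
    simpa using this.tendsto 0
  have hunit : ∀ᶠ x : S in 𝓝 1, IsUnit x := Units.isOpen.mem_nhds isUnit_one
  have hev : ∀ᶠ y in 𝓝 (F 1), ∃ u : Sˣ, F u = y := by
    rw [← hmap, eventually_map]
    filter_upwards [hunit] with x hx
    obtain ⟨u, rfl⟩ := hx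
    exact ⟨u, rfl⟩
  filter_upwards [htend.eventually hev] with s hs
  obtain ⟨u, hu⟩ := hs
  refine ⟨u, ?_⟩
  have key : (ξ + s • f) ∘ₗ V.subtype =
      ξ ∘ₗ ((unitConjLieEquiv u).toLinearEquiv : S →ₗ[ℂ] S) ∘ₗ V.subtype := by
    refine b.ext fun i => ?_
    rw [LinearMap.comp_apply]
    refine (congrFun hu i).symm.trans ?_
    simp [F, ξc, unitConjLieEquiv]
  exact fun v hv => LinearMap.congr_fun key ⟨v, hv⟩

/-- A form of Raïs' theorem on the index of a semi-direct product by an abelian ideal `V`, in the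
case of a form `ξ` on `V` with open orbit. -/
theorem lieIndex_eq_of_open_orbit {Q : Type*} [LieRing Q] [LieAlgebra ℂ Q] (V : Submodule ℂ S)
    (hl : ∀ x, ∀ v ∈ V, x * v ∈ V) (hr : ∀ x, ∀ v ∈ V, v * x ∈ V) (ξ : Dual ℂ S)
    (hV : ∀ v ∈ V, (∀ x : S, ξ ⁅x, v⁆ = 0) → v = 0)
    (ι : Q →ₗ⁅ℂ⁆ S) (hι : ∀ q, ι q ∈ V → q = 0)
    (hιV : ∀ q, ∀ v ∈ V, ξ ⁅ι q, v⁆ = 0)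
    (horth : ∀ x, (∀ v ∈ V, ξ ⁅x, v⁆ = 0) → ∃ q, x - ι q ∈ V) :
    lieIndex S = lieIndex Q := by
  have hlie : ∀ x, ∀ v ∈ V, ⁅x, v⁆ ∈ V := fun x v hv => by
    rw [Ring.lie_def]; exact V.sub_mem (hl x v hv) (hr x v hv)
  have main : ∀ f : Dual ℂ S, (∀ v ∈ V, f v = ξ v) → finrank ℂ (coadjointStabilizer f) =
      finrank ℂ (coadjointStabilizer (f ∘ₗ (ι : Q →ₗ[ℂ] S))) := fun f hf => by
    have hf' : ∀ x, ∀ v ∈ V, f ⁅x, v⁆ = ξ ⁅x, v⁆ := fun x v hv => hf _ (hlie x v hv)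
    refine finrank_coadjointStabilizer_of_orthogonal V f
      (fun v hv h => hV v hv fun x => by rw [← hf' x v hv, h]) ι hι
      (fun q v hv => by rw [hf' _ v hv, hιV q v hv])
      (fun x h => horth x fun v hv => by rw [← hf' x v hv, h v hv])
  apply le_antisymm
  -- Glue an optimal form on Q with ξ on V and extend the result to S.
  · obtain ⟨α, hα⟩ := exists_finrank_coadjointStabilizer_eq_lieIndex Q
    let s : Q × V →ₗ[ℂ] S := (ι : Q →ₗ[ℂ] S).coprod V.subtype
    have hs : s.ker = ⊥ := by
      rw [LinearMap.ker_eq_bot']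
      rintro ⟨q, v⟩ h
      have h0 : ι q + v = 0 := h
      have hq : q = 0 := hι q (by rw [eq_neg_of_add_eq_zero_left h0]; exact V.neg_mem v.2)
      subst hq
      have hv : (v : S) = 0 := by simpa using h0
      ext <;> simp [hv]
    obtain ⟨p, hp⟩ := LinearMap.exists_leftInverse_of_injective s hs
    let f : Dual ℂ S := (α.coprod (ξ ∘ₗ V.subtype)) ∘ₗ p
    have hps : ∀ z, p (s z) = z := fun z => LinearMap.congr_fun hp z
    have hf : ∀ v ∈ V, f v = ξ v := fun v hv => by
      have := hps (0, ⟨v, hv⟩)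
      have hsv : s (0, ⟨v, hv⟩) = v := by simp [s]
      rw [hsv] at this
      simp [f, this]
    have hfι : f ∘ₗ (ι : Q →ₗ[ℂ] S) = α := by
      ext q
      have := hps (q, 0)
      have hsq : s (q, 0) = ι q := by simp [s]
      rw [hsq] at this
      simp [f, this]
    rw [← hα, ← hfι, ← main f hf]
    exact lieIndex_le f
  -- For small generic s ≠ 0, ξ + s f has a stabilizer no larger than that of the optimal f, and on
  -- V it is conjugate to ξ. Conjugating back gives a form to which `main` applies.
  · obtain ⟨f, hf⟩ := exists_finrank_coadjointStabilizer_eq_lieIndex S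
    have h1 := eventually_exists_unit_conj V ξ f hV
    have h2 : ∀ᶠ s : ℂ in 𝓝[≠] 0, finrank ℂ (coadjointStabilizer (ξ + s • f)) ≤
        finrank ℂ (coadjointStabilizer f) := by
      have hfin := finite_finrank_coadjointStabilizer_lt_add_smul f ξ
      have := (hfin.subset (Set.sdiff_subset (t := {0}))).isClosed.isOpen_compl.mem_nhds
        (x := (0 : ℂ)) (by simp)
      filter_upwards [nhdsWithin_le_nhds this, self_mem_nhdsWithin] with s hs hs0
      by_contra hlt
      exact hs ⟨not_le.1 hlt, hs0⟩
    obtain ⟨s, ⟨u, hu⟩, hs⟩ := ((h1.filter_mono nhdsWithin_le_nhds).and h2).exists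
    let f' : Dual ℂ S := (ξ + s • f) ∘ₗ ((unitConjLieEquiv u).symm.toLinearEquiv : S →ₗ[ℂ] S)
    have hf' : ∀ v ∈ V, f' v = ξ v := fun v hv => by
      have h3 : f' v = (ξ + s • f) (↑u⁻¹ * v * u) := rfl
      rw [h3, hu _ (hr _ _ (hl _ _ hv))]
      simp [mul_assoc]
    rw [← hf]
    refine le_trans ?_ hs
    rw [finrank_coadjointStabilizer_congr (unitConjLieEquiv u) (ξ + s • f) f' fun x => by
      simp [f', unitConjLieEquiv], main f' hf']
    exact lieIndex_le _

end Algebra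

/-! ### Matrix algebras attached to preorders -/

/-- A preorder relation on the indices of square matrices, viewed as the set of the positions of
the entries that are allowed to be non-zero. -/
structure MatrixPattern (m : Type*) where
  /-- The allowed positions. -/
  rel : m → m → Prop
  refl : ∀ i, rel i i
  trans : ∀ {i j k}, rel i j → rel j k → rel i k

namespace MatrixPattern

open Matrix

variable {m n : Type*} [Fintype m] [Fintype n] [DecidableEq m] [DecidableEq n]

/-- The algebra of the matrices supported on the allowed positions. -/
def algebra (P : MatrixPattern m) : Subalgebra ℂ (Matrix m m ℂ) where
  carrier := {x | ∀ i j, ¬ P.rel i j → x i j = 0}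
  mul_mem' := fun {x y} hx hy i j hij => by
    rw [mul_apply]
    refine Finset.sum_eq_zero fun k _ => mul_eq_zero.2 ?_
    by_cases h : P.rel i k
    · exact Or.inr (hy k j fun h' => hij (P.trans h h'))
    · exact Or.inl (hx i k h)
  add_mem' := fun {x y} hx hy i j hij => by rw [Matrix.add_apply, hx i j hij, hy i j hij, add_zero]
  algebraMap_mem' := fun c i j hij => by
    rw [algebraMap_matrix_apply, if_neg]
    rintro rfl
    exact hij (P.refl i)

theorem coe_lie {P : MatrixPattern m} (x y : P.algebra) :
    ((⁅x, y⁆ : P.algebra) : Matrix m m ℂ) = x * y - y * x := rfl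

/-- The index of the Lie algebra of the matrices supported on the allowed positions. -/
noncomputable def index (P : MatrixPattern m) : ℕ := lieIndex P.algebra

theorem index_congr {P : MatrixPattern m} {Q : MatrixPattern n} (e : m ≃ n)
    (h : ∀ i j, P.rel i j ↔ Q.rel (e i) (e j)) : P.index = Q.index :=
  lieIndex_congr
    { toFun := fun x => ⟨x.1.submatrix e.symm e.symm, fun i j hij =>
        x.2 _ _ (by rw [h]; simpa using hij)⟩
      invFun := fun x => ⟨x.1.submatrix e e, fun i j hij => x.2 _ _ (by rwa [← h])⟩
      map_add' := fun x y => rfl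
      map_smul' := fun c x => rfl
      map_lie' := fun {x y} => Subtype.ext <| by
        simp only [coe_lie]
        rw [submatrix_sub, Pi.sub_apply, Pi.sub_apply, ← submatrix_mul_equiv _ _ _ e.symm,
          ← submatrix_mul_equiv _ _ _ e.symm]
      left_inv := fun x => Subtype.ext <| by simp
      right_inv := fun x => Subtype.ext <| by simp }

/-- The opposite relation. -/
def swap (P : MatrixPattern m) : MatrixPattern m where
  rel i j := P.rel j i
  refl := P.refl
  trans h h' := P.trans h' h

theorem index_swap (P : MatrixPattern m) : P.swap.index = P.index :=
  lieIndex_congr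
    { toFun := fun x => ⟨-x.1ᵀ, fun i j hij => neg_eq_zero.2 (x.2 j i hij)⟩
      invFun := fun x => ⟨-x.1ᵀ, fun i j hij => neg_eq_zero.2 (x.2 j i hij)⟩
      map_add' := fun x y => Subtype.ext <| by simp [add_comm]
      map_smul' := fun c x => Subtype.ext <| by simp
      map_lie' := fun {x y} => Subtype.ext <| by simp [coe_lie]
      left_inv := fun x => Subtype.ext <| by simp
      right_inv := fun x => Subtype.ext <| by simp }

/-- The block diagonal pattern. -/
def sum (P : MatrixPattern m) (Q : MatrixPattern n) : MatrixPattern (m ⊕ n) where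
  rel := Sum.LiftRel P.rel Q.rel
  refl i := by cases i <;> simp [P.refl, Q.refl]
  trans {i j k} h h' := by
    cases h with
    | inl h => cases h' with
      | inl h' => exact .inl (P.trans h h')
    | inr h => cases h' with
      | inr h' => exact .inr (Q.trans h h')

theorem index_sum (P : MatrixPattern m) (Q : MatrixPattern n) :
    (P.sum Q).index = P.index + Q.index :=
  lieIndex_of_prod
    { toFun := fun x => ⟨fromBlocks x.1.1 0 0 x.2.1, by
        rintro (i | i) (j | j) hij
        · exact x.1.2 i j fun h => hij (.inl h)
        · rfl
        · rfl
        · exact x.2.2 i j fun h => hij (.inr h)⟩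
      invFun := fun x => (⟨x.1.toBlocks₁₁, fun i j hij => x.2 _ _ (by simpa [sum] using hij)⟩,
        ⟨x.1.toBlocks₂₂, fun i j hij => x.2 _ _ (by simpa [sum] using hij)⟩)
      map_add' := fun x y => Subtype.ext <| by simp [fromBlocks_add]
      map_smul' := fun c x => Subtype.ext <| by simp [fromBlocks_smul]
      left_inv := fun x => by simp
      right_inv := fun x => Subtype.ext <| by
        have h₁ : x.1.toBlocks₁₂ = 0 := by
          ext i j; exact x.2 _ _ (by simp [sum])
        have h₂ : x.1.toBlocks₂₁ = 0 := by
          ext i j; exact x.2 _ _ (by simp [sum])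
        conv_rhs => rw [← fromBlocks_toBlocks x.1, h₁, h₂] }
    fun x y => Subtype.ext <| by
      simp [coe_lie, fromBlocks_multiply, sub_eq_add_neg, fromBlocks_neg, fromBlocks_add]

/-- The block upper triangular pattern, all positions in the upper right corner being allowed. -/
def triangular (P : MatrixPattern m) (Q : MatrixPattern n) : MatrixPattern (m ⊕ n) where
  rel := Sum.Lex P.rel Q.rel
  refl i := by cases i <;> simp [P.refl, Q.refl]
  trans {i j k} h h' := by
    cases h with
    | inl h => cases h' with
      | inl h' => exact .inl (P.trans h h')
      | sep => exact .sep _ _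
    | inr h => cases h' with
      | inr h' => exact .inr (Q.trans h h')
    | sep => cases h' with
      | inr h' => exact .sep _ _

/-- The positions allowed by `P` and, on the rows in the range of `ρ`, allowed by `Q`. -/
def restrict (P : MatrixPattern m) (Q : MatrixPattern n) (ρ : n ↪ m) : MatrixPattern m where
  rel i j := P.rel i j ∧ ∀ k, ρ k = i → ∃ l, ρ l = j ∧ Q.rel k l
  refl i := ⟨P.refl i, fun k hk => ⟨k, hk, Q.refl k⟩⟩
  trans := fun ⟨h₁, h₂⟩ ⟨h₁', h₂'⟩ => ⟨P.trans h₁ h₁', fun k hk => by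
    obtain ⟨l, hl, hkl⟩ := h₂ k hk
    obtain ⟨l', hl', hll'⟩ := h₂' l hl
    exact ⟨l', hl', Q.trans hkl hll'⟩⟩

/-! ### The corner ideal of a block triangular pattern -/

section Triangular

variable (P : MatrixPattern m) (Q : MatrixPattern n) (ρ : n ↪ m)

/-- The upper right corner of the block upper triangular matrices. -/
def corner : Submodule ℂ (P.triangular Q).algebra where
  carrier := {x | (∀ i j, x.1 (.inl i) (.inl j) = 0) ∧ ∀ i j, x.1 (.inr i) (.inr j) = 0}
  zero_mem' := ⟨fun _ _ => rfl, fun _ _ => rfl⟩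
  add_mem' := fun {x y} hx hy =>
    ⟨fun i j => by simp [hx.1 i j, hy.1 i j], fun i j => by simp [hx.2 i j, hy.2 i j]⟩
  smul_mem' := fun c x hx => ⟨fun i j => by simp [hx.1 i j], fun i j => by simp [hx.2 i j]⟩

/-- The linear form that takes the sum of the entries at the places `(ρ j, j)` of the upper right
corner. -/
def cornerForm : Module.Dual ℂ (P.triangular Q).algebra where
  toFun x := ∑ j, x.1 (.inl (ρ j)) (.inr j)
  map_add' x y := by simp [Finset.sum_add_distrib]
  map_smul' c x := by simp [Finset.mul_sum]

variable {P Q}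

theorem triangular_inr_inl (x : (P.triangular Q).algebra) (i : n) (j : m) :
    x.1 (.inr i) (.inl j) = 0 := x.2 _ _ (by simp [triangular])

theorem mul_mem_corner (x v : (P.triangular Q).algebra) (hv : v ∈ corner P Q) :
    x * v ∈ corner P Q := by
  constructor <;> intro i j <;>
    simp [mul_apply, hv.1, hv.2, triangular_inr_inl]

theorem mem_corner_mul (x v : (P.triangular Q).algebra) (hv : v ∈ corner P Q) :
    v * x ∈ corner P Q := by
  constructor <;> intro i j <;>
    simp [mul_apply, hv.1, hv.2, triangular_inr_inl]

theorem cornerForm_lie (x v : (P.triangular Q).algebra) (hv : v ∈ corner P Q) :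
    cornerForm P Q ρ ⁅x, v⁆ = ∑ j, ∑ i, x.1 (.inl (ρ j)) (.inl i) * v.1 (.inl i) (.inr j) -
      ∑ j, ∑ k, v.1 (.inl (ρ j)) (.inr k) * x.1 (.inr k) (.inr j) := by
  simp [cornerForm, coe_lie, mul_apply, hv.1, hv.2]

/-- Bracketing with the elementary matrix at (ρ j, i) or at (j, k) isolates, up to sign, one entry
of v. The hypothesis `h` says that every entry is reached in one of these two ways. -/
theorem eq_zero_of_cornerForm_lie
    (h : ∀ i j, P.rel (ρ j) i ∨ ∃ k, ρ k = i ∧ Q.rel j k)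
    (v : (P.triangular Q).algebra) (hv : v ∈ corner P Q)
    (hx : ∀ x : (P.triangular Q).algebra, cornerForm P Q ρ ⁅x, v⁆ = 0) : v = 0 := by
  have key : ∀ i j, v.1 (.inl i) (.inr j) = 0 := fun i j => by
    rcases h i j with hij | ⟨k, rfl, hjk⟩
    · have := hx ⟨single (.inl (ρ j)) (.inl i) 1, fun a b hab => by
        rw [single_apply, if_neg]
        rintro ⟨rfl, rfl⟩
        exact hab (.inl hij)⟩
      rw [cornerForm_lie ρ _ v hv] at this
      simpa [single_apply, ite_and] using this
    · have := hx ⟨single (.inr j) (.inr k) 1, fun a b hab => by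
        rw [single_apply, if_neg]
        rintro ⟨rfl, rfl⟩
        exact hab (.inr hjk)⟩
      rw [cornerForm_lie ρ _ v hv] at this
      simpa [single_apply, ite_and] using this
  ext (i | i) (j | j)
  · exact hv.1 i j
  · exact key i j
  · exact triangular_inr_inl v i j
  · exact hv.2 i j

/-- Testing orthogonality against the elementary matrix at (i, j) of the corner shows that the rows
ρ j of the first block are copies of the rows of the second. -/
theorem apply_eq_of_cornerForm_lie (x : (P.triangular Q).algebra)
    (hx : ∀ v ∈ corner P Q, cornerForm P Q ρ ⁅x, v⁆ = 0) (j : n) (i : m) :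
    x.1 (.inl (ρ j)) (.inl i) = ∑ k, if ρ k = i then x.1 (.inr j) (.inr k) else 0 := by
  let v : (P.triangular Q).algebra := ⟨single (.inl i) (.inr j) 1, fun a b hab => by
    rw [single_apply, if_neg]
    rintro ⟨rfl, rfl⟩
    exact hab (.sep _ _)⟩
  have hv : v ∈ corner P Q := ⟨fun _ _ => by simp [v], fun _ _ => by simp [v]⟩
  have := hx v hv
  rw [cornerForm_lie ρ _ v hv] at this
  refine sub_eq_zero.1 (Eq.trans ?_ this)
  simp [v, single_apply, ite_and, eq_comm (a := i)]

theorem restrict_sum_mul (x : (P.restrict Q ρ).algebra) (k : n) (f : m → ℂ) :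
    ∑ i, x.1 (ρ k) i * f i = ∑ l, x.1 (ρ k) (ρ l) * f (ρ l) := by
  refine (Fintype.sum_of_injective ρ ρ.injective _ _ (fun i hi => ?_) fun _ => rfl).symm
  rw [x.2, zero_mul]
  rintro ⟨-, h⟩
  obtain ⟨l, hl, -⟩ := h k rfl
  exact hi ⟨l, hl⟩

/-- The embedding of the matrices with pattern `P.restrict Q ρ` as block diagonal matrices. -/
def restrictHom : (P.restrict Q ρ).algebra →ₗ⁅ℂ⁆ (P.triangular Q).algebra where
  toFun x := ⟨fromBlocks x.1 0 0 (x.1.submatrix ρ ρ), by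
    rintro (i | i) (j | j) hij
    · exact x.2 i j fun h => hij (.inl h.1)
    · rfl
    · rfl
    · refine x.2 _ _ fun h => hij ?_
      obtain ⟨l, hl, hil⟩ := h.2 i rfl
      rw [ρ.injective hl] at hil
      exact .inr hil⟩
  map_add' x y := Subtype.ext <| by simp [fromBlocks_add]; rfl
  map_smul' c x := Subtype.ext <| by simp [fromBlocks_smul]; rfl
  map_lie' {x y} := Subtype.ext <| by
    have hmul : ∀ x y : (P.restrict Q ρ).algebra,
        (x.1 * y.1).submatrix ρ ρ = x.1.submatrix ρ ρ * y.1.submatrix ρ ρ := fun x y => by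
      ext i j
      rw [submatrix_apply, mul_apply, restrict_sum_mul ρ x i, mul_apply]
      rfl
    simp [coe_lie, fromBlocks_multiply, sub_eq_add_neg, fromBlocks_neg, fromBlocks_add,
      ← hmul]
    rfl

/-- The condition `h` makes the orbit of the corner form open; modulo the corner, its stabilizer is
the image of `restrictHom`. -/
theorem index_triangular (h : ∀ i j, P.rel (ρ j) i ∨ ∃ k, ρ k = i ∧ Q.rel j k) :
    (P.triangular Q).index = (P.restrict Q ρ).index := by
  -- Any algebra norm serves: it only gives access to the calculus of the orbit map.
  let _ : NormedRing (Matrix (m ⊕ n) (m ⊕ n) ℂ) := Matrix.linftyOpNormedRing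
  let _ : NormedAlgebra ℂ (Matrix (m ⊕ n) (m ⊕ n) ℂ) := Matrix.linftyOpNormedAlgebra
  refine lieIndex_eq_of_open_orbit (S := (P.triangular Q).algebra) (corner P Q) mul_mem_corner
    mem_corner_mul (cornerForm P Q ρ) (eq_zero_of_cornerForm_lie ρ h) (restrictHom ρ) ?_ ?_ ?_
  · intro q hq
    ext i j
    exact hq.1 i j
  · intro q v hv
    refine (cornerForm_lie ρ _ v hv).trans ?_
    change ∑ j, ∑ i, q.1 (ρ j) i * v.1 (.inl i) (.inr j) -
      ∑ j, ∑ k, v.1 (.inl (ρ j)) (.inr k) * q.1 (ρ k) (ρ j) = 0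
    rw [sub_eq_zero, Finset.sum_comm (f := fun j k => v.1 (.inl (ρ j)) (.inr k) * _)]
    refine Finset.sum_congr rfl fun j _ => ?_
    rw [restrict_sum_mul ρ q j fun i => v.1 (.inl i) (.inr j)]
    exact Finset.sum_congr rfl fun k _ => mul_comm _ _
  · intro x hx
    have key := apply_eq_of_cornerForm_lie ρ x hx
    have hkey : ∀ j k, x.1 (.inl (ρ j)) (.inl (ρ k)) = x.1 (.inr j) (.inr k) := fun j k => by
      simp [key]
    refine ⟨⟨x.1.toBlocks₁₁, fun i j hij => ?_⟩, fun i j => sub_self _, fun i j => ?_⟩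
    -- A position allowed by P but not by the restricted pattern lies in some row ρ k, and Q forbids
    -- (k, l) for every l over j; the entry is then a sum of zeros by `key`.
    · by_cases hP : P.rel i j
      · have hij' : ∃ k, ρ k = i ∧ ∀ l, ρ l = j → ¬ Q.rel k l := by
          by_contra hcon
          push Not at hcon
          exact hij ⟨hP, fun k hk => hcon k hk⟩
        obtain ⟨k, rfl, hk⟩ := hij'
        refine (key k j).trans (Finset.sum_eq_zero fun l _ => ?_)
        split_ifs with hl
        · exact x.2 _ _ fun h => hk l hl (by simpa [triangular] using h)
        · rfl
      · exact x.2 _ _ fun h => hP (by simpa [triangular] using h)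
    · exact sub_eq_zero.2 (hkey i j).symm

end Triangular

end MatrixPattern

/-! ### Partial sums of concatenated and reversed sequences -/

theorem zero_mem_partialSums (a : List ℕ) : 0 ∈ partialSums a := ⟨0, Nat.zero_le _, rfl⟩

theorem le_sum_of_mem_partialSums {a : List ℕ} {m : ℕ} (hm : m ∈ partialSums a) : m ≤ a.sum := by
  obtain ⟨i, -, rfl⟩ := hm
  conv_rhs => rw [← List.take_append_drop i a, List.sum_append]
  exact Nat.le_add_right _ _

theorem forall_mem_partialSums_append {a b : List ℕ} {φ : ℕ → Prop} :
    (∀ m ∈ partialSums (a ++ b), φ m) ↔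
      (∀ m ∈ partialSums a, φ m) ∧ ∀ m ∈ partialSums b, φ (a.sum + m) := by
  induction a generalizing φ with
  | nil =>
    have h0 : ∀ m ∈ partialSums [], m = 0 := fun m hm =>
      Nat.le_zero.1 (le_sum_of_mem_partialSums hm)
    simp only [List.nil_append, List.sum_nil, zero_add]
    exact ⟨fun h => ⟨fun m hm => h0 m hm ▸ h 0 (zero_mem_partialSums b), h⟩, And.right⟩
  | cons x a ih =>
    have key : ∀ (c : List ℕ) (φ : ℕ → Prop), (∀ m ∈ partialSums (x :: c), φ m) ↔
        φ 0 ∧ ∀ m ∈ partialSums c, φ (x + m) := fun c φ => by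
      rw [partialSums_cons]
      simp
    rw [List.cons_append, key, key, ih, and_assoc, List.sum_cons]
    simp only [add_assoc]

theorem forall_mem_partialSums_singleton {n : ℕ} {φ : ℕ → Prop} :
    (∀ m ∈ partialSums [n], φ m) ↔ φ 0 ∧ φ n := by
  rw [partialSums_cons]
  constructor
  · intro h
    exact ⟨h 0 (by simp), h n (Or.inr ⟨0, zero_mem_partialSums _, rfl⟩)⟩
  · rintro ⟨h0, hn⟩ m (rfl | ⟨k, hk, rfl⟩)
    · exact h0
    · rw [Nat.le_zero.1 (le_sum_of_mem_partialSums hk)]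
      exact hn

theorem forall_mem_partialSums_reverse {a : List ℕ} {φ : ℕ → Prop} :
    (∀ m ∈ partialSums a.reverse, φ m) ↔ ∀ m ∈ partialSums a, φ (a.sum - m) := by
  induction a generalizing φ with
  | nil =>
    have h0 : ∀ m ∈ partialSums [], m = 0 := fun m hm =>
      Nat.le_zero.1 (le_sum_of_mem_partialSums hm)
    exact ⟨fun h m hm => h0 m hm ▸ h m hm, fun h m hm => h0 m hm ▸ h m hm⟩
  | cons x a ih =>
    rw [List.reverse_cons, forall_mem_partialSums_append, forall_mem_partialSums_singleton, ih,
      List.sum_reverse, ← List.singleton_append, forall_mem_partialSums_append,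
      forall_mem_partialSums_singleton]
    simp only [List.sum_append, List.sum_singleton, Nat.sub_zero, add_zero, Nat.add_sub_add_left,
      Nat.add_sub_cancel_left, add_comm a.sum x]
    have h1 : a.sum ∈ partialSums a := ⟨a.length, le_rfl, by simp⟩
    have h0 := zero_mem_partialSums a
    grind

/-! ### Symmetries and block decomposition of biparabolic subalgebras -/

/-- The positions of the entries of the matrices in `biparabolic n a b` that may be non-zero. -/
def biparabolicPattern (n : ℕ) (a b : List ℕ) : MatrixPattern (Fin n) where
  rel r s := (∀ m ∈ partialSums a, m ≤ (r : ℕ) → m ≤ (s : ℕ)) ∧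
    ∀ m ∈ partialSums b, m ≤ (s : ℕ) → m ≤ (r : ℕ)
  refl _ := ⟨fun _ _ => id, fun _ _ => id⟩
  trans h h' := ⟨fun m hm => h'.1 m hm ∘ h.1 m hm, fun m hm => h.2 m hm ∘ h'.2 m hm⟩

theorem mem_biparabolic {n : ℕ} {a b : List ℕ} {x : Matrix (Fin n) (Fin n) ℂ} :
    x ∈ biparabolic n a b ↔ x ∈ (biparabolicPattern n a b).algebra := by
  constructor
  · rintro ⟨h₁, h₂⟩ r s hrs
    by_contra hx
    refine hrs ⟨fun m hm hr => ?_, fun m hm hs => ?_⟩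
    · by_contra hs
      exact hx (h₁ m hm r s (not_le.1 hs) hr)
    · by_contra hr
      exact hx (h₂ m hm r s hs (not_le.1 hr))
  · intro h
    exact ⟨fun m hm r s hs hr => h r s fun h' => absurd (h'.1 m hm hr) (not_le.2 hs),
      fun m hm r s hs hr => h r s fun h' => absurd (h'.2 m hm hs) (not_le.2 hr)⟩

theorem biparabolicIndex_eq (n : ℕ) (a b : List ℕ) :
    biparabolicIndex n a b = (biparabolicPattern n a b).index :=
  lieIndex_congr
    { toFun := fun x => ⟨x.1, mem_biparabolic.1 x.2⟩
      invFun := fun x => ⟨x.1, mem_biparabolic.2 x.2⟩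
      map_add' := fun _ _ => rfl
      map_smul' := fun _ _ => rfl
      map_lie' := rfl
      left_inv := fun _ => rfl
      right_inv := fun _ => rfl }

theorem biparabolicIndex_swap (n : ℕ) (a b : List ℕ) :
    biparabolicIndex n b a = biparabolicIndex n a b := by
  rw [biparabolicIndex_eq, biparabolicIndex_eq, ← MatrixPattern.index_swap]
  exact MatrixPattern.index_congr (Equiv.refl _) fun i j => and_comm

/-- Reversing the basis exchanges initial and final coordinate subspaces, so it also exchanges the
roles of a and b; the swap symmetry restores them. -/
theorem biparabolicIndex_reverse {n : ℕ} {a b : List ℕ} (ha : a.sum = n) (hb : b.sum = n) :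
    biparabolicIndex n a.reverse b.reverse = biparabolicIndex n a b := by
  rw [← biparabolicIndex_swap, biparabolicIndex_eq, biparabolicIndex_eq]
  refine MatrixPattern.index_congr Fin.revPerm fun i j => ?_
  have key : ∀ m ≤ n, ∀ i : Fin n, m ≤ (Fin.rev i : ℕ) ↔ ¬ n - m ≤ (i : ℕ) := fun m hm i => by
    rw [Fin.val_rev]; omega
  simp only [biparabolicPattern, forall_mem_partialSums_reverse, Fin.revPerm_apply, ha, hb]
  rw [and_comm]
  refine and_congr (forall₂_congr fun m hm => ?_) (forall₂_congr fun m hm => ?_)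
  · have := le_sum_of_mem_partialSums hm
    rw [key m (by omega), key m (by omega), not_imp_not]
  · have := le_sum_of_mem_partialSums hm
    rw [key m (by omega), key m (by omega), not_imp_not]

/-- At a common cut s both coordinate subspaces are stable, so the matrices are block diagonal. The
partial sum 0 of `a'` and `b'` records this cut. -/
theorem biparabolicIndex_append {s t : ℕ} {a a' b b' : List ℕ} (ha : a.sum = s) (hb : b.sum = s) :
    biparabolicIndex (s + t) (a ++ a') (b ++ b') =
      biparabolicIndex s a b + biparabolicIndex t a' b' := by
  simp only [biparabolicIndex_eq]
  rw [← MatrixPattern.index_sum]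
  symm
  refine MatrixPattern.index_congr finSumFinEquiv ?_
  have h0 := zero_mem_partialSums a'
  have h0' := zero_mem_partialSums b'
  rintro (i | i) (j | j) <;>
    simp only [MatrixPattern.sum, biparabolicPattern, forall_mem_partialSums_append,
      finSumFinEquiv_apply_left, finSumFinEquiv_apply_right, Sum.liftRel_inl_inl,
      Sum.liftRel_inr_inr, Sum.not_liftRel_inl_inr, Sum.not_liftRel_inr_inl,
      Fin.val_castAdd, Fin.val_natAdd, ha, hb]
  · have := i.2
    have := j.2
    constructor
    · rintro ⟨h₁, h₂⟩
      exact ⟨⟨h₁, by omega⟩, h₂, by omega⟩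
    · rintro ⟨⟨h₁, -⟩, h₂, -⟩
      exact ⟨h₁, h₂⟩
  · have := i.2
    simp only [false_iff]
    rintro ⟨-, -, h⟩
    have := h 0 h0'
    omega
  · have := j.2
    simp only [false_iff]
    rintro ⟨⟨-, h⟩, -⟩
    have := h 0 h0
    omega
  · have h1 : ∀ m ∈ partialSums a, m ≤ s := fun m hm => ha ▸ le_sum_of_mem_partialSums hm
    have h2 : ∀ m ∈ partialSums b, m ≤ s := fun m hm => hb ▸ le_sum_of_mem_partialSums hm
    simp only [Nat.add_le_add_iff_left]
    constructor
    · rintro ⟨h₁, h₂⟩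
      exact ⟨⟨fun m hm _ => (h1 m hm).trans (Nat.le_add_right _ _), h₁⟩,
        fun m hm _ => (h2 m hm).trans (Nat.le_add_right _ _), h₂⟩
    · rintro ⟨⟨-, h₁⟩, -, h₂⟩
      exact ⟨h₁, h₂⟩

/-! ### Reduction of parabolic subalgebras to biparabolic ones -/

theorem biparabolicPattern_singleton_rel {n : ℕ} {a : List ℕ} {r s : Fin n} :
    (biparabolicPattern n a [n]).rel r s ↔ ∀ m ∈ partialSums a, m ≤ (r : ℕ) → m ≤ (s : ℕ) := by
  have := r.2
  have := s.2
  refine and_iff_left ?_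
  rw [forall_mem_partialSums_singleton]
  omega

theorem biparabolicPattern_triangular_rel {A B : ℕ} {a b : List ℕ} (ha : a.sum = A)
    (i j : Fin A ⊕ Fin B) :
    ((biparabolicPattern A a [A]).triangular (biparabolicPattern B b [B])).rel i j ↔
      (biparabolicPattern (A + B) (a ++ b) [A + B]).rel (finSumFinEquiv i) (finSumFinEquiv j) := by
  have h0 := zero_mem_partialSums b
  have h1 : ∀ m ∈ partialSums a, m ≤ A := fun m hm => ha ▸ le_sum_of_mem_partialSums hm
  rcases i with i | i <;> rcases j with j | j <;>
    simp only [biparabolicPattern_singleton_rel, MatrixPattern.triangular,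
      forall_mem_partialSums_append, finSumFinEquiv_apply_left, finSumFinEquiv_apply_right,
      Sum.lex_inl_inl, Sum.lex_inr_inr, Sum.lex_inr_inl, Sum.Lex.sep, Fin.val_castAdd,
      Fin.val_natAdd, ha]
  · have := i.2
    exact ⟨fun h => ⟨h, by omega⟩, And.left⟩
  · have := i.2
    exact ⟨fun _ => ⟨fun m hm _ => (h1 m hm).trans (Nat.le_add_right _ _), by omega⟩,
      fun _ => trivial⟩
  · have := j.2
    simp only [false_iff]
    rintro ⟨-, h⟩
    have := h 0 h0
    omega
  · simp only [Nat.add_le_add_iff_left]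
    exact ⟨fun h => ⟨fun m hm _ => (h1 m hm).trans (Nat.le_add_right _ _), h⟩, And.right⟩

/-- The range of ρ is the first B indices, listed backwards, so upper triangular blocks become lower
triangular ones in reverse order. Rows below B must also vanish in columns from B on, which is the
cut before the last term A − B; on the other rows both conditions are vacuous. -/
theorem biparabolicPattern_restrict_rel {A B : ℕ} {a b : List ℕ} (hb : b.sum = B)
    (hBA : B ≤ A) (ρ : Fin B ↪ Fin A) (hρ : ∀ j, (ρ j : ℕ) = B - (j + 1)) (i j : Fin A) :
    ((biparabolicPattern A a [A]).restrict (biparabolicPattern B b.reverse [B]) ρ).rel i j ↔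
      (biparabolicPattern A a (b ++ [A - B])).rel i j := by
  have h1 : ∀ m ∈ partialSums b, m ≤ B := fun m hm => hb ▸ le_sum_of_mem_partialSums hm
  have hj := j.2
  simp only [MatrixPattern.restrict, biparabolicPattern_singleton_rel,
    forall_mem_partialSums_reverse]
  refine and_congr_right fun _ => ?_
  rw [forall_mem_partialSums_append, forall_mem_partialSums_singleton, hb]
  have hsurj : ∀ i : Fin A, (i : ℕ) < B → ∃ k, ρ k = i := fun i hi =>
    ⟨⟨B - (i + 1), by omega⟩, Fin.ext (by rw [hρ]; simp only; omega)⟩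
  by_cases hi : (i : ℕ) < B
  · obtain ⟨k, rfl⟩ := hsurj i hi
    have hk := hρ k
    constructor
    · intro h
      obtain ⟨l, rfl, hl⟩ := h k rfl
      have hl' := hρ l
      refine ⟨fun m hm hml => ?_, by omega, by omega⟩
      by_contra hmk
      have := h1 m hm
      have := hl m hm (by omega)
      omega
    · rintro ⟨h, h', -⟩ k' hk'
      obtain rfl := ρ.injective hk'
      obtain ⟨l, rfl⟩ := hsurj j (by omega)
      have hl' := hρ l
      refine ⟨l, rfl, fun m hm hmk => ?_⟩
      by_contra hml
      have := h1 m hm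
      have := h m hm (by omega)
      omega
  · constructor
    · intro _
      refine ⟨fun m hm _ => (h1 m hm).trans (not_lt.1 hi), by omega, by omega⟩
    · rintro - k rfl
      have := hρ k
      have := k.2
      omega

/-- The reduction of the index of a parabolic subalgebra to the index of a biparabolic subalgebra of
smaller rank. -/
theorem parabolicIndex_append {A B : ℕ} {a b : List ℕ} (ha : a.sum = A) (hb : b.sum = B)
    (hBA : B ≤ A) :
    parabolicIndex (A + B) (a ++ b) = biparabolicIndex A a (b.reverse ++ [A - B]) := by
  change biparabolicIndex _ _ _ = _
  let ρ : Fin B ↪ Fin A := ⟨fun j => Fin.castLE hBA j.rev, fun i j hij => by simpa using hij⟩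
  have hρ : ∀ j, (ρ j : ℕ) = B - (j + 1) := fun j => Fin.val_rev j
  rw [biparabolicIndex_eq, biparabolicIndex_eq,
    ← MatrixPattern.index_congr finSumFinEquiv (biparabolicPattern_triangular_rel ha),
    ← MatrixPattern.index_congr (Equiv.refl _)
      (biparabolicPattern_restrict_rel (b.sum_reverse.trans hb) hBA ρ hρ), List.reverse_reverse]
  refine MatrixPattern.index_triangular ρ fun i j => ?_
  have hj := hρ j
  -- On or right of the diagonal, (ρ j, i) is allowed in the first block. Otherwise i < ρ j < B, so
  -- i = ρ k with k > j, and (j, k) is allowed in the second.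
  by_cases hij : (ρ j : ℕ) ≤ i
  · exact Or.inl (biparabolicPattern_singleton_rel.2 fun m _ hm => hm.trans hij)
  · refine Or.inr ⟨⟨B - (i + 1), by omega⟩, Fin.ext ?_, biparabolicPattern_singleton_rel.2 ?_⟩
    · rw [hρ]
      simp only
      omega
    · intro m _ hm
      simp only
      omega

theorem biparabolicIndex_append_zero (n : ℕ) (a b : List ℕ) :
    biparabolicIndex n a (b ++ [0]) = biparabolicIndex n a b := by
  have h : biparabolic n a (b ++ [0]) = biparabolic n a b := by
    rw [← biparabolic_filter n a (b ++ [0]), ← biparabolic_filter n a b]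
    simp
  rw [biparabolicIndex, biparabolicIndex, h]

theorem biparabolicIndex_eq_parabolicIndex {n : ℕ} {a b : List ℕ} (ha : a.sum = n)
    (hb : b.sum = n) :
    biparabolicIndex n a b = parabolicIndex (n + n) (a ++ b.reverse) := by
  rw [parabolicIndex_append ha (b.sum_reverse.trans hb) le_rfl, List.reverse_reverse, Nat.sub_self,
    biparabolicIndex_append_zero]

theorem parabolicIndex_reverse {n : ℕ} {a : List ℕ} (ha : a.sum = n) :
    parabolicIndex n a.reverse = parabolicIndex n a :=
  biparabolicIndex_reverse ha (b := [n]) (by simp)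

theorem parabolicIndex_append_of_le {A B : ℕ} {a b : List ℕ} (ha : a.sum = A) (hb : b.sum = B)
    (hAB : A ≤ B) :
    parabolicIndex (A + B) (a ++ b) = biparabolicIndex B (a ++ [B - A]) b.reverse := by
  rw [← parabolicIndex_reverse (by rw [List.sum_append, ha, hb]), List.reverse_append, add_comm,
    parabolicIndex_append (b.sum_reverse.trans hb) (a.sum_reverse.trans ha) hAB,
    List.reverse_reverse, biparabolicIndex_swap]

/-- Reducing along the cut after a gives 𝔮(a, m ∣ c reversed, b reversed), which splits at the
common cut s. -/
theorem parabolicIndex_append_append {s m : ℕ} {a b c : List ℕ} (ha : a.sum = s) (hb : b.sum = m)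
    (hc : c.sum = s) :
    parabolicIndex (s + (m + s)) (a ++ (b ++ c)) =
      parabolicIndex (s + s) (a ++ c) + parabolicIndex m b := by
  rw [parabolicIndex_append_of_le ha (by rw [List.sum_append, hb, hc]) (Nat.le_add_left _ _),
    Nat.add_sub_cancel, List.reverse_append, Nat.add_comm m s,
    biparabolicIndex_append ha (c.sum_reverse.trans hc),
    biparabolicIndex_eq_parabolicIndex ha (c.sum_reverse.trans hc), List.reverse_reverse,
    biparabolicIndex_swap]
  exact congrArg _ (parabolicIndex_reverse hb)

theorem mainTheorem3 (n : ℕ) (a b : Composition n) :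
    -- 1)
    biparabolicIndex n a.blocks b.blocks = biparabolicIndex n b.blocks a.blocks ∧
    -- 2)
    biparabolicIndex n a.blocks b.blocks =
      biparabolicIndex n a.blocks.reverse b.blocks.reverse ∧
    -- 3)
    biparabolicIndex n a.blocks b.blocks =
      parabolicIndex (2 * n) (a.blocks ++ b.blocks.reverse) ∧
    -- 4)
    (∀ i : ℕ, 1 ≤ i → i < a.length →
      ∀ t : ℤ, t = ((a.blocks.take i).sum : ℤ) - ((a.blocks.drop i).sum : ℤ) →
        (0 ≤ t → parabolicIndex n a.blocks =
          biparabolicIndex (a.blocks.take i).sum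
            (a.blocks.take i) ((a.blocks.drop i).reverse ++ [t.toNat])) ∧
        (t < 0 → parabolicIndex n a.blocks =
          biparabolicIndex (a.blocks.drop i).sum
            (a.blocks.take i ++ [(-t).toNat]) (a.blocks.drop i).reverse)) ∧
    -- 5)
    (∀ i i' : ℕ, 1 ≤ i → i < a.length → i + 1 < i' → i' ≤ a.length →
      (a.blocks.take i).sum = (a.blocks.drop (i' - 1)).sum →
        parabolicIndex n a.blocks =
          parabolicIndex ((a.blocks.take i).sum + (a.blocks.drop (i' - 1)).sum)
            (a.blocks.take i ++ a.blocks.drop (i' - 1)) +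
          parabolicIndex ((a.blocks.take (i' - 1)).drop i).sum
            ((a.blocks.take (i' - 1)).drop i)) ∧
    -- 6)
    (∀ i j : ℕ, 1 ≤ i → i < a.length → 1 ≤ j → j < b.length →
      (a.blocks.take i).sum = (b.blocks.take j).sum →
        biparabolicIndex n a.blocks b.blocks =
          biparabolicIndex (a.blocks.take i).sum (a.blocks.take i) (b.blocks.take j) +
          biparabolicIndex (a.blocks.drop i).sum (a.blocks.drop i) (b.blocks.drop j)) := by
  have ha := a.blocks_sum
  have hb := b.blocks_sum
  have hsplit : ∀ (c : Composition n) (i : ℕ), (c.blocks.take i).sum + (c.blocks.drop i).sum = n :=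
    fun c i => by rw [← List.sum_append, List.take_append_drop, c.blocks_sum]
  refine ⟨biparabolicIndex_swap _ _ _, (biparabolicIndex_reverse ha hb).symm, ?_, ?_, ?_, ?_⟩
  · rw [two_mul]
    exact biparabolicIndex_eq_parabolicIndex ha hb
  · rintro i - - t rfl
    have hn : parabolicIndex n a.blocks =
        parabolicIndex ((a.blocks.take i).sum + (a.blocks.drop i).sum)
          (a.blocks.take i ++ a.blocks.drop i) := by
      rw [hsplit, List.take_append_drop]
    refine ⟨fun ht => ?_, fun ht => ?_⟩
    · rw [hn, parabolicIndex_append rfl rfl (by omega)]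
      congr 3
      omega
    · rw [hn, parabolicIndex_append_of_le rfl rfl (by omega)]
      congr 3
      omega
  · intro i i' _ _ hi _ h
    -- With terms numbered from 1, the tail starting at the term of number i' is `drop (i' - 1)`.
    have hdrop : a.blocks.drop i =
        (a.blocks.take (i' - 1)).drop i ++ a.blocks.drop (i' - 1) := by
      conv_lhs => rw [← List.take_append_drop (i' - 1) a.blocks]
      rw [List.drop_append_of_le_length]
      rw [List.length_take, Composition.blocks_length]
      omega
    have key := parabolicIndex_append_append (a := a.blocks.take i)
      (b := (a.blocks.take (i' - 1)).drop i) (c := a.blocks.drop (i' - 1)) rfl rfl h.symm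
    have hn := hsplit a i
    rw [hdrop, List.sum_append, ← h] at hn
    rw [← hdrop, List.take_append_drop, hn] at key
    rw [key, ← h]
  · intro i j _ _ _ _ h
    have key := biparabolicIndex_append (t := (a.blocks.drop i).sum) (a := a.blocks.take i)
      (a' := a.blocks.drop i) (b := b.blocks.take j) (b' := b.blocks.drop j) rfl h.symm
    rwa [List.take_append_drop, List.take_append_drop, hsplit] at key
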